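/- **Theorem 5.2.** Let $l,n,m,p$ be natural numbers, $\Lambda=\{1,\dots,l\}$, $K=\{1,\dots,m\}$, $J=\{1,\dots,p\}$, and let $\mathcal I$ be the set of closed bounded intervals $[a,b]$, $a\le b$, of $\mathbb R$, with center $\frac{a+b}{2}$, width $\frac{b-a}{2}$ and addition $[a,b]+[c,d]=[a+c,b+d]$. For $Q,R\in\mathcal I$ write $Q\prec_{CW}R$ if both the center and the width of $Q$ are strictly smaller than those of $R$. Consider the game in which player $i\in\Lambda$ has the strategy set $S^i=\{y\in\mathbb R^n: g^i_j(y)\le 0\ \forall j\in J\}$ with $g^i_j:\mathbb R^n\to\mathbb R$, and the interval-valued losses $F^i_k:(\mathbb R^n)^l\to\mathcal I$, $k\in K$. For a profile $\bar u=(\bar u_1,\dots,\bar u_l)$ let $F^i_k(y,\bar u_{-i})$ be the value of $F^i_k$ at the profile obtained from $\bar u$ by replacing $\bar u_i$ with $y$. Given $\varepsilon\in\mathbb R^m_+$, a profile $\bar u\in\prod_{i\in\Lambda}S^i$ is a *weak $\varepsilon$-quasi Nash equilibrium* if for no $i\in\Lambda$ there is $y\in S^i$ with $$F^i_k(y,\bar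 u_{-i})+[0,\varepsilon_k\|\bar u_i-y\|]\prec_{CW}F^i_k(\bar u)\qquad\text{for all }k\in K.$$ For locally Lipschitz $\psi:\mathbb R^n\to\mathbb R$ let $\psi^0(z;w)=\limsup_{v\to z,\,t\to0^+}\frac{\psi(v+tw)-\psi(v)}{t}$, and let $\partial^0\psi(z)=\{z^*\in\mathbb R^n:\langle z^*,w\rangle\le\psi^0(z;w)\ \forall w\in\mathbb R^n\}$ be the Clarke generalized gradient. A function $f=[\underline f,\overline f]:\mathbb R^n\to\mathcal I$ is locally Lipschitz if every point has a neighbourhood $U$ and a constant $L>0$ such that $\max\{|\underline f(v)-\underline f(w)|,|\overline f(v)-\overline f(w)|\}\le L\|v-w\|$ for all $v,w\in U$; then $\partial^0 f(z)$ denotes the convex hull of $\partial^0 f^c(z)\cup\partial^0 f^w(z)$, where $f^c,f^w$ are the center and the width of $f$. For $y\in S^i$ let $I^i(y)=\{j\in J:g^i_j(y)=0\}$. The *basic constraint qualification* (BCQ) holds at $y\in S^i$ if there is no $\mu\in\mathbb R^p_+\setminus\{0\}$ with $\mu_j=0$ for all $j\notin I^i(y)$ and $0\in\sum_{j\in J}\mu_j\,\partial^0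 g^i_j(y)$. Let $\varepsilon\in\mathbb R^m_+\setminus\{0\}$ and let $\bar u$ be a weak $\varepsilon$-quasi Nash equilibrium. Suppose that for all $i\in\Lambda$, $k\in K$, $j\in J$ the functions $F^i_k(\cdot,\bar u_{-i})$ and $g^i_j$ are locally Lipschitz on $\mathbb R^n$, and that BCQ holds at $\bar u_i\in S^i$ for all $i\in\Lambda$. Then for every $i\in\Lambda$ there exist $\lambda^i\in\mathbb R^m_+$ with $\sum_{k\in K}\lambda^i_k=1$ and $\mu^i\in\mathbb R^p_+$ such that $$0\in\sum_{k\in K}\lambda^i_k\,\partial^0F^i_k(\cdot,\bar u_{-i})(\bar u_i)+\sum_{j\in I^i(\bar u_i)}\mu^i_j\,\partial^0g^i_j(\bar u_i)+\sum_{k\in K}\lambda^i_k\varepsilon_k\,\mathbb B^n,\qquad \mu^i_j\,g^i_j(\bar u_i)=0\quad\forall j\in J,$$ where $\mathbb B^n$ is the closed Euclidean unit ball and sums of sets are Minkowski sums. -/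

import Mathlib

open Filter Topology
open scoped Pointwise NNReal

noncomputable section

namespace IntervalGame

/-- The space `ℝⁿ` with its Euclidean norm and inner product. -/
abbrev E (n : ℕ) : Type := EuclideanSpace ℝ (Fin n)

/-- The set `𝓘` of nonempty closed bounded intervals `[a, b]`, `a ≤ b`, of the real line.
The addition `[a, b] + [c, d] = [a + c, b + d]` is the one of Mathlib. -/
abbrev Intv : Type := NonemptyInterval ℝ

/-! ### Intervals -/

/-- The center `(a + b) / 2` of the interval `[a, b]`. -/
def center (Q : Intv) : ℝ := (Q.fst + Q.snd) / 2

/-- The (half-)width `(b - a) / 2` of the interval `[a, b]`. -/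
def width (Q : Intv) : ℝ := (Q.snd - Q.fst) / 2

/-- The strict center-width order `Q ≺_CW R`. -/
def LtCW (Q R : Intv) : Prop := center Q < center R ∧ width Q < width R

/-- The norm `‖[a, b]‖ = max {|a|, |b|}` of an interval. -/
def intvNorm (Q : Intv) : ℝ := max |Q.fst| |Q.snd|

/-- The interval `[0, r]` for `r ≥ 0`. -/
def zeroTo (r : ℝ≥0) : Intv := ⟨(0, (r : ℝ)), r.coe_nonneg⟩

/-- The generalized Hukuhara difference of two intervals, by its explicit formula
(see `gHDiff_eq_iff` for the defining property). -/
def gHDiff (Q R : Intv) : Intv :=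
  ⟨(min (Q.fst - R.fst) (Q.snd - R.snd), max (Q.fst - R.fst) (Q.snd - R.snd)), min_le_max⟩

/-- `Q ⊖ R = P` if and only if `Q = R + P` or `R = Q - P = Q + (-1) P`. -/
theorem gHDiff_eq_iff (Q R P : Intv) : gHDiff Q R = P ↔ Q = R + P ∨ R = Q - P := by
  obtain ⟨⟨a, b⟩, hab⟩ := Q
  obtain ⟨⟨c, d⟩, hcd⟩ := R
  obtain ⟨⟨e, f⟩, hef⟩ := P
  have h1 : ∀ A B : Intv, A = B ↔ A.fst = B.fst ∧ A.snd = B.snd := by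
    intro A B
    rw [NonemptyInterval.ext_iff, Prod.ext_iff]
  rw [h1, h1, h1, NonemptyInterval.fst_sub, NonemptyInterval.snd_sub,
    NonemptyInterval.toProd_add]
  simp only [gHDiff, Prod.fst_add, Prod.snd_add] at *
  rcases le_total (a - c) (b - d) with h | h
  · rw [min_eq_left h, max_eq_right h]
    constructor
    · rintro ⟨h1, h2⟩
      left; constructor <;> linarith
    · rintro (⟨h1, h2⟩ | ⟨h1, h2⟩) <;> constructor <;> linarith
  · rw [min_eq_right h, max_eq_left h]
    constructor
    · rintro ⟨h1, h2⟩
      right; constructor <;> linarith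
    · rintro (⟨h1, h2⟩ | ⟨h1, h2⟩) <;> constructor <;> linarith

/-- Local Lipschitz continuity on `ℝⁿ` of an interval-valued function. -/
def IntvLocallyLipschitz {n : ℕ} (f : E n → Intv) : Prop :=
  ∀ u₀ : E n, ∃ U ∈ 𝓝 u₀, ∃ L : ℝ, 0 < L ∧
    ∀ u₁ ∈ U, ∀ u₂ ∈ U, intvNorm (gHDiff (f u₁) (f u₂)) ≤ L * ‖u₁ - u₂‖

/-! ### Clarke calculus -/

/-- The Clarke directional derivative `ψ⁰(z; w)`, the upper limit of
`(ψ (u + t w) - ψ u) / t` as `u → z` and `t → 0⁺` (for `ψ` locally Lipschitz, where the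
quotients are bounded near the limit). -/
def clarkeDeriv {n : ℕ} (ψ : E n → ℝ) (z w : E n) : ℝ :=
  limsup (fun q : E n × ℝ => (ψ (q.1 + q.2 • w) - ψ q.1) / q.2) (𝓝 z ×ˢ 𝓝[>] (0 : ℝ))

/-- The Clarke generalized gradient `∂⁰ψ(z)`. -/
def clarkeGrad {n : ℕ} (ψ : E n → ℝ) (z : E n) : Set (E n) :=
  {x | ∀ w : E n, inner ℝ x w ≤ clarkeDeriv ψ z w}

/-- The weakly generalized gradient of an interval-valued function: the convex hull of the
generalized gradients of its center and of its width. -/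
def weakGrad {n : ℕ} (f : E n → Intv) (u : E n) : Set (E n) :=
  convexHull ℝ (clarkeGrad (fun v => center (f v)) u ∪ clarkeGrad (fun v => width (f v)) u)

/-! ### Constraints -/

/-- The set `{u : g_j(u) ≤ 0 for all j}`. -/
def feasible {n p : ℕ} (g : Fin p → E n → ℝ) : Set (E n) := {u | ∀ j, g j u ≤ 0}

open Classical in
/-- The set `I(u) = {j : g_j(u) = 0}` of active indices. -/
def active {n p : ℕ} (g : Fin p → E n → ℝ) (u : E n) : Finset (Fin p) :=
  Finset.univ.filter fun j => g j u = 0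

/-- The basic constraint qualification at `u`; the sum is the Minkowski sum of sets. -/
def BCQ {n p : ℕ} (g : Fin p → E n → ℝ) (u : E n) : Prop :=
  ¬ ∃ μ : Fin p → ℝ, (∀ j, 0 ≤ μ j) ∧ μ ≠ 0 ∧ (∀ j, j ∉ active g u → μ j = 0) ∧
    (0 : E n) ∈ ∑ j, μ j • clarkeGrad (g j) u

/-! ### The game -/

/-- A noncooperative game with `l` players, each having `m` interval-valued loss functions
and a strategy set in `ℝⁿ` that is described by `p` inequality constraints. -/
structure Game (l n m p : ℕ) where
  /-- the constraint functions `gⁱ_j` of player `i` -/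
  g : Fin l → Fin p → E n → ℝ
  /-- the interval-valued loss functions `Fⁱ_k` of player `i` -/
  F : Fin l → Fin m → (Fin l → E n) → Intv

/-- The strategy set `Sⁱ` of player `i`. -/
def Game.strategySet {l n m p : ℕ} (G : Game l n m p) (i : Fin l) : Set (E n) :=
  feasible (G.g i)

/-- The loss `y ↦ Fⁱ_k(y, u₋ᵢ)` of player `i` as a function of that player's own strategy. -/
def Game.ownLoss {l n m p : ℕ} (G : Game l n m p) (u : Fin l → E n) (i : Fin l) (k : Fin m)
    (y : E n) : Intv :=
  G.F i k (Function.update u i y)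

/-- `u` is a weak `ε`-quasi Nash equilibrium: a strategy profile such that no player `i` has
a strategy `y` with `Fⁱ_k(y, u₋ᵢ) + [0, ε_k ‖u_i - y‖] ≺_CW Fⁱ_k(u)` for all `k`. -/
def Game.IsWeakQuasiNash {l n m p : ℕ} (G : Game l n m p) (ε : Fin m → ℝ≥0)
    (u : Fin l → E n) : Prop :=
  (∀ i, u i ∈ G.strategySet i) ∧
    ∀ i, ¬ ∃ y ∈ G.strategySet i, ∀ k,
      LtCW (G.ownLoss u i k y + zeroTo (ε k * ‖u i - y‖₊)) (G.F i k u)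

end IntervalGame

end

namespace IntervalGame

variable {n : ℕ}

/-! ### The Clarke derivative of a locally Lipschitz function -/

/-! Fix a player `i`. Near `u i` every point `y` fails to improve some function of a finite family.
If `y` is feasible, the equilibrium gives a loss whose center or width, plus `ε k / 2 * ‖y - u i‖`,
does not drop; the half appears because `[0, r]` has center and width `r / 2`. If `y` is infeasible,
inactive constraints are still negative by continuity, so some active constraint is positive, hence
above its value `0` at `u i`.

Such a weak local minimum forces `0` to be a convex combination of elements of the sets `∂⁰ψ_a + c_a
𝔹` (`exists_multipliers_of_local_weak_min`). Otherwise separation yields `w` with `ψ_a⁰(w) < -c_a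
‖w‖` for all `a`, and a short step along `w` improves every function at once. This uses that `ψ⁰` is
the support function of `∂⁰ψ`, a Hahn–Banach statement; no sum rule is needed.

These are Fritz John multipliers. BCQ prevents all the weight from lying on the constraints, so
dividing by the weight `s` of the losses normalises them. The center and width weights of each loss
merge because `weakGrad` is convex. -/

theorem tendsto_add_smul_clarke (z w : E n) :
    Tendsto (fun q : E n × ℝ => q.1 + q.2 • w) (𝓝 z ×ˢ 𝓝[>] (0 : ℝ)) (𝓝 z) := by
  have h : Tendsto (fun q : E n × ℝ => q.1 + q.2 • w) (𝓝 z ×ˢ 𝓝 (0 : ℝ)) (𝓝 z) := by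
    rw [← nhds_prod_eq]
    have hc : Continuous fun q : E n × ℝ => q.1 + q.2 • w := by fun_prop
    simpa using hc.tendsto (z, (0 : ℝ))
  exact h.mono_left (Filter.prod_mono le_rfl nhdsWithin_le_nhds)

theorem eventually_clarke_pos (z : E n) :
    ∀ᶠ q : E n × ℝ in 𝓝 z ×ˢ 𝓝[>] (0 : ℝ), 0 < q.2 :=
  tendsto_snd.eventually self_mem_nhdsWithin

/-- Supplies the boundedness without which a real `limsup` is a junk value. `L` does not depend on
`w`, which later makes `clarkeGrad` bounded. -/
theorem exists_eventually_abs_quotient_le {ψ : E n → ℝ} (hψ : LocallyLipschitz ψ) (z : E n) :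
    ∃ L : ℝ, 0 ≤ L ∧ ∀ w : E n, ∀ᶠ q : E n × ℝ in 𝓝 z ×ˢ 𝓝[>] (0 : ℝ),
      |(ψ (q.1 + q.2 • w) - ψ q.1) / q.2| ≤ L * ‖w‖ := by
  obtain ⟨K, U, hU, hK⟩ := hψ z
  refine ⟨K, K.coe_nonneg, fun w => ?_⟩
  filter_upwards [(tendsto_add_smul_clarke z w).eventually hU, tendsto_fst.eventually hU,
    eventually_clarke_pos z] with q h1 h2 h3
  have h := hK.dist_le_mul _ h1 _ h2
  rw [Real.dist_eq, dist_eq_norm, add_sub_cancel_left, norm_smul, Real.norm_of_nonneg h3.le] at h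
  rw [abs_div, abs_of_pos h3, div_le_iff₀ h3]
  linarith

theorem eventually_quotient_lt {ψ : E n → ℝ} (hψ : LocallyLipschitz ψ) {z w : E n} {c : ℝ}
    (hc : clarkeDeriv ψ z w < c) :
    ∀ᶠ q : E n × ℝ in 𝓝 z ×ˢ 𝓝[>] (0 : ℝ), (ψ (q.1 + q.2 • w) - ψ q.1) / q.2 < c := by
  obtain ⟨L, -, hL⟩ := exists_eventually_abs_quotient_le hψ z
  exact eventually_lt_of_limsup_lt hc
    ⟨L * ‖w‖, eventually_map.2 ((hL w).mono fun _ h => (abs_le.1 h).2)⟩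

theorem clarkeDeriv_le {ψ : E n → ℝ} (hψ : LocallyLipschitz ψ) {z w : E n} {c : ℝ}
    (h : ∀ᶠ q : E n × ℝ in 𝓝 z ×ˢ 𝓝[>] (0 : ℝ), (ψ (q.1 + q.2 • w) - ψ q.1) / q.2 ≤ c) :
    clarkeDeriv ψ z w ≤ c := by
  obtain ⟨L, -, hL⟩ := exists_eventually_abs_quotient_le hψ z
  have hb : IsBoundedUnder (· ≥ ·) (𝓝 z ×ˢ 𝓝[>] (0 : ℝ))
      (fun q : E n × ℝ => (ψ (q.1 + q.2 • w) - ψ q.1) / q.2) :=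
    ⟨-(L * ‖w‖), eventually_map.2 ((hL w).mono fun _ h => (abs_le.1 h).1)⟩
  exact limsup_le_of_le hb.isCoboundedUnder_le h

theorem exists_clarkeDeriv_le_norm {ψ : E n → ℝ} (hψ : LocallyLipschitz ψ) (z : E n) :
    ∃ L : ℝ, 0 ≤ L ∧ ∀ w, clarkeDeriv ψ z w ≤ L * ‖w‖ := by
  obtain ⟨L, hL0, hL⟩ := exists_eventually_abs_quotient_le hψ z
  exact ⟨L, hL0, fun w => clarkeDeriv_le hψ ((hL w).mono fun _ h => (abs_le.1 h).2)⟩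

/-- The upper limit lets the base point move: the quotient along `w₁ + w₂` is one along `w₁` based
at `q.1 + q.2 • w₂` plus one along `w₂` based at `q.1`. -/
theorem clarkeDeriv_add_le {ψ : E n → ℝ} (hψ : LocallyLipschitz ψ) (z w₁ w₂ : E n) :
    clarkeDeriv ψ z (w₁ + w₂) ≤ clarkeDeriv ψ z w₁ + clarkeDeriv ψ z w₂ := by
  refine le_of_forall_pos_le_add fun η hη => clarkeDeriv_le hψ ?_
  have h1 := eventually_quotient_lt hψ (lt_add_of_pos_right (clarkeDeriv ψ z w₁) (half_pos hη))
  have h2 := eventually_quotient_lt hψ (lt_add_of_pos_right (clarkeDeriv ψ z w₂) (half_pos hη))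
  have ht : Tendsto (fun q : E n × ℝ => (q.1 + q.2 • w₂, q.2)) (𝓝 z ×ˢ 𝓝[>] (0 : ℝ))
      (𝓝 z ×ˢ 𝓝[>] (0 : ℝ)) := (tendsto_add_smul_clarke z w₂).prodMk tendsto_snd
  filter_upwards [ht.eventually h1, h2] with q hq1 hq2
  have he : q.1 + q.2 • (w₁ + w₂) = q.1 + q.2 • w₂ + q.2 • w₁ := by
    rw [smul_add]; abel
  have hs : (ψ (q.1 + q.2 • (w₁ + w₂)) - ψ q.1) / q.2 =
      (ψ (q.1 + q.2 • w₂ + q.2 • w₁) - ψ (q.1 + q.2 • w₂)) / q.2 +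
        (ψ (q.1 + q.2 • w₂) - ψ q.1) / q.2 := by
    rw [he]; ring
  rw [hs]
  linarith

theorem clarkeDeriv_smul_le {ψ : E n → ℝ} (hψ : LocallyLipschitz ψ) (z w : E n) {c : ℝ}
    (hc : 0 < c) : clarkeDeriv ψ z (c • w) ≤ c * clarkeDeriv ψ z w := by
  rw [← div_le_iff₀' hc]
  refine le_of_forall_pos_le_add fun η hη => ?_
  rw [div_le_iff₀' hc]
  refine clarkeDeriv_le hψ ?_
  have h1 := eventually_quotient_lt hψ (lt_add_of_pos_right (clarkeDeriv ψ z w) hη)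
  have hm : Tendsto (fun t : ℝ => t * c) (𝓝[>] (0 : ℝ)) (𝓝[>] (0 : ℝ)) := by
    refine tendsto_nhdsWithin_iff.2 ⟨?_, ?_⟩
    · have h : Continuous fun t : ℝ => t * c := by fun_prop
      simpa using (h.tendsto 0).mono_left nhdsWithin_le_nhds
    · filter_upwards [self_mem_nhdsWithin] with t ht using mul_pos ht hc
  have ht : Tendsto (fun q : E n × ℝ => (q.1, q.2 * c)) (𝓝 z ×ˢ 𝓝[>] (0 : ℝ))
      (𝓝 z ×ˢ 𝓝[>] (0 : ℝ)) := tendsto_fst.prodMk (hm.comp tendsto_snd)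
  filter_upwards [ht.eventually h1, eventually_clarke_pos z] with q hq1 hq2
  simp only [← smul_smul] at hq1
  rw [div_lt_iff₀ (mul_pos hq2 hc)] at hq1
  rw [div_le_iff₀ hq2]
  linarith

theorem clarkeDeriv_smul {ψ : E n → ℝ} (hψ : LocallyLipschitz ψ) (z w : E n) {c : ℝ}
    (hc : 0 < c) : clarkeDeriv ψ z (c • w) = c * clarkeDeriv ψ z w := by
  refine le_antisymm (clarkeDeriv_smul_le hψ z w hc) ?_
  have h := clarkeDeriv_smul_le hψ z (c • w) (inv_pos.2 hc)
  rw [smul_smul, inv_mul_cancel₀ hc.ne', one_smul] at h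
  calc c * clarkeDeriv ψ z w ≤ c * (c⁻¹ * clarkeDeriv ψ z (c • w)) := by gcongr
    _ = clarkeDeriv ψ z (c • w) := by field_simp

theorem clarkeDeriv_zero {ψ : E n → ℝ} (hψ : LocallyLipschitz ψ) (z : E n) :
    clarkeDeriv ψ z 0 = 0 := by
  have h := clarkeDeriv_smul hψ z 0 (c := 2) two_pos
  rw [smul_zero] at h
  linarith

/-! ### The Clarke generalized gradient -/

/-- Hahn–Banach: the functional `c • w ↦ c * ψ⁰(z; w)` on the line through `w` is dominated by the
sublinear `ψ⁰(z; ·)`, and a dominated extension is an element of `∂⁰ψ(z)`. -/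
theorem exists_mem_clarkeGrad_le_inner {ψ : E n → ℝ} (hψ : LocallyLipschitz ψ) (z w : E n) :
    ∃ x ∈ clarkeGrad ψ z, clarkeDeriv ψ z w ≤ inner ℝ x w := by
  let f : E n →ₗ.[ℝ] ℝ := LinearPMap.mkSpanSingleton' w (clarkeDeriv ψ z w) (by
    intro c hc
    rcases smul_eq_zero.1 hc with rfl | rfl
    · simp
    · simp [clarkeDeriv_zero hψ])
  obtain ⟨φ, hφ1, hφ2⟩ := exists_extension_of_le_sublinear f (clarkeDeriv ψ z)
    (fun c hc x => clarkeDeriv_smul hψ z x hc) (clarkeDeriv_add_le hψ z) (by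
      rintro ⟨x, hx⟩
      obtain ⟨c, rfl⟩ := Submodule.mem_span_singleton.1 hx
      rw [LinearPMap.mkSpanSingleton'_apply]
      simp only [smul_eq_mul, RingHom.id_apply]
      -- For `c < 0`, subadditivity gives `0 = ψ⁰(0) ≤ ψ⁰(c • w) + (-c) * ψ⁰(w)`.
      rcases lt_trichotomy c 0 with hc | rfl | hc
      · have h1 := clarkeDeriv_add_le hψ z (c • w) ((-c) • w)
        rw [clarkeDeriv_smul hψ z w (neg_pos.2 hc), neg_smul, add_neg_cancel,
          clarkeDeriv_zero hψ] at h1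
        linarith
      · simp [clarkeDeriv_zero hψ]
      · rw [clarkeDeriv_smul hψ z w hc])
  have hin : ∀ v, inner ℝ ((InnerProductSpace.toDual ℝ (E n)).symm
      (LinearMap.toContinuousLinearMap φ)) v = φ v := fun v => by
    rw [InnerProductSpace.toDual_symm_apply]; rfl
  refine ⟨(InnerProductSpace.toDual ℝ (E n)).symm (LinearMap.toContinuousLinearMap φ),
    fun v => (hin v).trans_le (hφ2 v), ?_⟩
  rw [hin]
  have h := hφ1 ⟨w, Submodule.mem_span_singleton_self w⟩
  exact (h.trans (LinearPMap.mkSpanSingleton'_apply_self _ _ _ _)).ge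

theorem clarkeGrad_nonempty {ψ : E n → ℝ} (hψ : LocallyLipschitz ψ) (z : E n) :
    (clarkeGrad ψ z).Nonempty :=
  let ⟨x, hx, _⟩ := exists_mem_clarkeGrad_le_inner hψ z 0
  ⟨x, hx⟩

theorem convex_clarkeGrad (ψ : E n → ℝ) (z : E n) : Convex ℝ (clarkeGrad ψ z) := by
  intro x hx y hy a b ha hb hab w
  rw [inner_add_left, real_inner_smul_left, real_inner_smul_left]
  calc a * inner ℝ x w + b * inner ℝ y w
      ≤ a * clarkeDeriv ψ z w + b * clarkeDeriv ψ z w :=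
        add_le_add (mul_le_mul_of_nonneg_left (hx w) ha) (mul_le_mul_of_nonneg_left (hy w) hb)
    _ = clarkeDeriv ψ z w := by rw [← add_mul, hab, one_mul]

theorem isCompact_clarkeGrad {ψ : E n → ℝ} (hψ : LocallyLipschitz ψ) (z : E n) :
    IsCompact (clarkeGrad ψ z) := by
  obtain ⟨L, hL0, hL⟩ := exists_clarkeDeriv_le_norm hψ z
  refine (isCompact_closedBall (0 : E n) L).of_isClosed_subset ?_ fun x hx => ?_
  · simp only [clarkeGrad, Set.ofPred_forall]
    exact isClosed_iInter fun w => isClosed_le (by fun_prop) continuous_const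
  · rw [mem_closedBall_zero_iff]
    have h := (hx x).trans (hL x)
    rw [real_inner_self_eq_norm_sq] at h
    by_contra! hlt
    nlinarith

/-! ### A theorem of the alternative -/

/-- The convex combinations of one point from each `D a` form a compact convex set `C`. If `0` is
not in `C`, a separating functional is positive on all of `C`, and its negative contradicts `h`. -/
theorem exists_convex_combination_eq_zero {ι : Type*} [Fintype ι] {D : ι → Set (E n)}
    (hconv : ∀ a, Convex ℝ (D a)) (hcomp : ∀ a, IsCompact (D a))
    (h : ∀ w : E n, ∃ a, ∃ x ∈ D a, 0 ≤ inner ℝ x w) (hne : ∀ a, (D a).Nonempty) :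
    ∃ (α : ι → ℝ) (x : ι → E n), (∀ a, 0 ≤ α a) ∧ ∑ a, α a = 1 ∧ (∀ a, x a ∈ D a) ∧
      ∑ a, α a • x a = 0 := by
  classical
  let T : (ι → ℝ) × (ι → E n) → E n := fun q => ∑ a, q.1 a • q.2 a
  let C : Set (E n) := T '' (stdSimplex ℝ ι ×ˢ Set.univ.pi D)
  have hC : IsCompact C :=
    ((isCompact_stdSimplex ℝ ι).prod (isCompact_univ_pi hcomp)).image
      (by simp only [T]; fun_prop)
  have hCconv : Convex ℝ C := by
    rintro _ ⟨⟨α, x⟩, ⟨hα, hx⟩, rfl⟩ _ ⟨⟨β, y⟩, ⟨hβ, hy⟩, rfl⟩ s t hs ht hst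
    -- `T` is not linear in the pair of weights and points, so the points must be recombined with
    -- weights `s * α a` and `t * β a`, which convexity of `D a` allows.
    have hz : ∀ a, ∃ z ∈ D a, (s * α a + t * β a) • z = (s * α a) • x a + (t * β a) • y a :=
      fun a => (hconv a).exists_mem_add_smul_eq (hx a trivial) (hy a trivial)
        (mul_nonneg hs (hα.1 a)) (mul_nonneg ht (hβ.1 a))
    choose z hzD hz using hz
    refine ⟨(s • α + t • β, z), ⟨convex_stdSimplex ℝ ι hα hβ hs ht hst, fun a _ => hzD a⟩, ?_⟩
    simp only [T, Pi.add_apply, Pi.smul_apply, smul_eq_mul, hz, Finset.sum_add_distrib,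
      Finset.smul_sum, smul_smul]
  by_cases h0 : (0 : E n) ∈ C
  · obtain ⟨⟨α, x⟩, ⟨hα, hx⟩, hT⟩ := h0
    exact ⟨α, x, hα.1, hα.2, fun a => hx a trivial, hT⟩
  · exfalso
    obtain ⟨f, r, hf0, hfC⟩ := geometric_hahn_banach_point_closed hCconv hC.isClosed h0
    rw [map_zero] at hf0
    obtain ⟨a, x, hx, hax⟩ := h (-(InnerProductSpace.toDual ℝ (E n)).symm f)
    rw [inner_neg_right, real_inner_comm, InnerProductSpace.toDual_symm_apply] at hax
    choose y hy using hne
    -- A vertex of the simplex selects `x`; the other coordinates are arbitrary points, which is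
    -- where nonemptiness enters.
    have hmem : x ∈ C := by
      refine ⟨(Pi.single a 1, Function.update y a x), ⟨single_mem_stdSimplex ℝ a, ?_⟩, ?_⟩
      · intro b _
        rcases eq_or_ne b a with rfl | hb
        · simpa using hx
        · simpa [hb] using hy b
      · simp only [T]
        rw [Finset.sum_eq_single a (fun b _ hb => by simp [hb]) (by simp)]
        simp
    linarith [hfC x hmem]

/-- Multiplier rule: if no point near `z` strictly decreases all `ψ a + c a * ‖· - z‖`, then
`0` is a convex combination of elements of the sets `∂⁰ψ_a(z) + c_a 𝔹`. -/
theorem exists_multipliers_of_local_weak_min {ι : Type*} [Fintype ι] {ψ : ι → E n → ℝ}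
    (hψ : ∀ a, LocallyLipschitz (ψ a)) {c : ι → ℝ} (hc : ∀ a, 0 ≤ c a) {z : E n}
    (hmin : ∀ᶠ y in 𝓝 z, ∃ a, ψ a z ≤ ψ a y + c a * ‖y - z‖) :
    ∃ (α : ι → ℝ) (x y : ι → E n), (∀ a, 0 ≤ α a) ∧ ∑ a, α a = 1 ∧
      (∀ a, x a ∈ clarkeGrad (ψ a) z) ∧ (∀ a, ‖y a‖ ≤ c a) ∧
      ∑ a, α a • (x a + y a) = 0 := by
  obtain ⟨α, d, hα, hα1, hd, hsum⟩ := exists_convex_combination_eq_zero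
    (D := fun a => clarkeGrad (ψ a) z + Metric.closedBall (0 : E n) (c a))
    (fun a => (convex_clarkeGrad _ _).add (convex_closedBall _ _))
    (fun a => (isCompact_clarkeGrad (hψ a) z).add (isCompact_closedBall _ _)) (by
      intro w
      by_contra! hw
      have hlt : ∀ a, clarkeDeriv (ψ a) z w < -(c a * ‖w‖) := by
        intro a
        obtain ⟨x, hx, hxw⟩ := exists_mem_clarkeGrad_le_inner (hψ a) z w
        -- The point of the ball furthest along `w`, with inner product `c a * ‖w‖`. For `w = 0` the
        -- quotient is `0` and the bound still holds.
        have hb : (c a / ‖w‖) • w ∈ Metric.closedBall (0 : E n) (c a) := by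
          rw [mem_closedBall_zero_iff, norm_smul, norm_div, norm_norm,
            Real.norm_of_nonneg (hc a)]
          rcases eq_or_ne ‖w‖ 0 with h0 | h0
          · simpa [h0] using hc a
          · rw [div_mul_cancel₀ _ h0]
        have h := hw a _ (Set.add_mem_add hx hb)
        rw [inner_add_left, real_inner_smul_left, real_inner_self_eq_norm_sq] at h
        have h2 : c a / ‖w‖ * ‖w‖ ^ 2 = c a * ‖w‖ := by
          rcases eq_or_ne ‖w‖ 0 with h0 | h0
          · simp [h0]
          · field_simp
        linarith
      -- Only quotients based at `z` itself are needed from here on.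
      have ht : Tendsto (fun t : ℝ => (z, t)) (𝓝[>] (0 : ℝ)) (𝓝 z ×ˢ 𝓝[>] (0 : ℝ)) :=
        tendsto_const_nhds.prodMk tendsto_id
      have hall : ∀ᶠ t : ℝ in 𝓝[>] (0 : ℝ), ∀ a,
          (ψ a (z + t • w) - ψ a z) / t < -(c a * ‖w‖) :=
        eventually_all.2 fun a => ht.eventually (eventually_quotient_lt (hψ a) (hlt a))
      obtain ⟨t, ⟨ht1, ht2⟩, ht3⟩ := ((hall.and
        (((tendsto_add_smul_clarke z w).comp ht).eventually hmin)).and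
          self_mem_nhdsWithin).exists
      obtain ⟨a, ha⟩ := ht2
      have ht0 : 0 < t := ht3
      have h := ht1 a
      rw [div_lt_iff₀ ht0] at h
      simp only [Function.comp_apply, add_sub_cancel_left, norm_smul,
        Real.norm_of_nonneg ht0.le] at ha
      linarith)
    (fun a => (clarkeGrad_nonempty (hψ a) z).add ⟨0, Metric.mem_closedBall_self (hc a)⟩)
  choose x hx y hy hxy using fun a => Set.mem_add.1 (hd a)
  refine ⟨α, x, y, hα, hα1, hx, fun a => mem_closedBall_zero_iff.1 (hy a), ?_⟩
  simpa only [hxy] using hsum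

/-! ### Interval-valued functions -/

theorem center_add (Q R : Intv) : center (Q + R) = center Q + center R := by
  simp only [center, NonemptyInterval.toProd_add, Prod.fst_add, Prod.snd_add]
  ring

theorem width_add (Q R : Intv) : width (Q + R) = width Q + width R := by
  simp only [width, NonemptyInterval.toProd_add, Prod.fst_add, Prod.snd_add]
  ring

theorem center_zeroTo (r : ℝ≥0) : center (zeroTo r) = r / 2 := by simp [center, zeroTo]

theorem width_zeroTo (r : ℝ≥0) : width (zeroTo r) = r / 2 := by simp [width, zeroTo]

/-- The endpoints of `gHDiff Q R` are the two endpoint differences in increasing order. -/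
theorem abs_sub_fst_le (Q R : Intv) : |Q.fst - R.fst| ≤ intvNorm (gHDiff Q R) := by
  simp only [intvNorm, gHDiff]
  rcases le_total (Q.fst - R.fst) (Q.snd - R.snd) with h | h
  · rw [min_eq_left h, max_eq_right h]; exact le_max_left _ _
  · rw [min_eq_right h, max_eq_left h]; exact le_max_right _ _

theorem abs_sub_snd_le (Q R : Intv) : |Q.snd - R.snd| ≤ intvNorm (gHDiff Q R) := by
  simp only [intvNorm, gHDiff]
  rcases le_total (Q.fst - R.fst) (Q.snd - R.snd) with h | h
  · rw [min_eq_left h, max_eq_right h]; exact le_max_right _ _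
  · rw [min_eq_right h, max_eq_left h]; exact le_max_left _ _

theorem IntvLocallyLipschitz.of_abs_sub_le {f : E n → Intv} (hf : IntvLocallyLipschitz f)
    {h : Intv → ℝ} (hh : ∀ Q R, |h Q - h R| ≤ intvNorm (gHDiff Q R)) :
    LocallyLipschitz fun v => h (f v) := by
  intro z
  obtain ⟨U, hU, L, hL, hUL⟩ := hf z
  refine ⟨⟨L, hL.le⟩, U, hU, LipschitzOnWith.of_dist_le_mul fun x hx y hy => ?_⟩
  rw [Real.dist_eq, dist_eq_norm]
  exact (hh _ _).trans (hUL x hx y hy)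

theorem IntvLocallyLipschitz.center {f : E n → Intv} (hf : IntvLocallyLipschitz f) :
    LocallyLipschitz fun v => center (f v) := by
  refine hf.of_abs_sub_le fun Q R => ?_
  have h1 := abs_le.1 (abs_sub_fst_le Q R)
  have h2 := abs_le.1 (abs_sub_snd_le Q R)
  simp only [IntervalGame.center]
  exact abs_le.2 ⟨by linarith [h1.1, h2.1], by linarith [h1.2, h2.2]⟩

theorem IntvLocallyLipschitz.width {f : E n → Intv} (hf : IntvLocallyLipschitz f) :
    LocallyLipschitz fun v => width (f v) := by
  refine hf.of_abs_sub_le fun Q R => ?_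
  have h1 := abs_le.1 (abs_sub_fst_le Q R)
  have h2 := abs_le.1 (abs_sub_snd_le Q R)
  simp only [IntervalGame.width]
  exact abs_le.2 ⟨by linarith [h1.2, h2.1], by linarith [h1.1, h2.2]⟩

/-- Merges the center and width multipliers of one loss: `(a + b) • C = a • C + b • C` for convex
`C` and nonnegative `a`, `b`. -/
theorem smul_add_smul_mem_smul_weakGrad {f : E n → Intv} {z x y : E n}
    (hx : x ∈ clarkeGrad (fun v => center (f v)) z)
    (hy : y ∈ clarkeGrad (fun v => width (f v)) z) {a b : ℝ} (ha : 0 ≤ a) (hb : 0 ≤ b) :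
    a • x + b • y ∈ (a + b) • weakGrad f z := by
  have hc : Convex ℝ (weakGrad f z) := convex_convexHull _ _
  rw [hc.add_smul ha hb]
  exact Set.add_mem_add
    (Set.smul_mem_smul_set (subset_convexHull _ _ (Or.inl hx)))
    (Set.smul_mem_smul_set (subset_convexHull _ _ (Or.inr hy)))

theorem smul_add_smul_mem_smul_closedBall {x y : E n} {e : ℝ} (he : 0 ≤ e) (hx : ‖x‖ ≤ e / 2)
    (hy : ‖y‖ ≤ e / 2) {a b : ℝ} (ha : 0 ≤ a) (hb : 0 ≤ b) :
    a • x + b • y ∈ ((a + b) * e) • Metric.closedBall (0 : E n) 1 := by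
  have hab : 0 ≤ (a + b) * e := mul_nonneg (add_nonneg ha hb) he
  rw [smul_unitClosedBall_of_nonneg hab, mem_closedBall_zero_iff]
  calc ‖a • x + b • y‖ ≤ ‖a • x‖ + ‖b • y‖ := norm_add_le _ _
    _ = a * ‖x‖ + b * ‖y‖ := by
      rw [norm_smul, norm_smul, Real.norm_of_nonneg ha, Real.norm_of_nonneg hb]
    _ ≤ a * (e / 2) + b * (e / 2) := by gcongr
    -- A factor of two is given away here: half the radius would suffice.
    _ ≤ (a + b) * e := by linarith

end IntervalGame

/-! ### Necessary conditions at an equilibrium -/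

open IntervalGame in
theorem IntervalGame.Game.IsWeakQuasiNash.not_strictly_better {l n m p : ℕ} {G : Game l n m p}
    {ε : Fin m → ℝ≥0} {u : Fin l → E n} (hu : G.IsWeakQuasiNash ε u) (i : Fin l) {y : E n}
    (hy : y ∈ G.strategySet i) :
    ∃ k, center (G.ownLoss u i k (u i)) ≤
        center (G.ownLoss u i k y) + (ε k : ℝ) / 2 * ‖y - u i‖ ∨
      width (G.ownLoss u i k (u i)) ≤
        width (G.ownLoss u i k y) + (ε k : ℝ) / 2 * ‖y - u i‖ := by
  by_contra! h
  refine hu.2 i ⟨y, hy, fun k => ?_⟩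
  have hk := h k
  have he : G.ownLoss u i k (u i) = G.F i k u := by simp [Game.ownLoss]
  rw [he, norm_sub_rev] at hk
  refine ⟨?_, ?_⟩
  · rw [center_add, center_zeroTo, NNReal.coe_mul, coe_nnnorm]
    linarith [hk.1]
  · rw [width_add, width_zeroTo, NNReal.coe_mul, coe_nnnorm]
    linarith [hk.2]

open IntervalGame in
theorem theorem5p2 {l n m p : ℕ} (G : IntervalGame.Game l n m p)
    (ε : Fin m → ℝ≥0) (hε : ε ≠ 0)
    (u : Fin l → IntervalGame.E n) (hu : G.IsWeakQuasiNash ε u)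
    (hF : ∀ i k, IntervalGame.IntvLocallyLipschitz (G.ownLoss u i k))
    (hg : ∀ i j, LocallyLipschitz (G.g i j))
    (hBCQ : ∀ i, IntervalGame.BCQ (G.g i) (u i)) :
    ∀ i, ∃ (lam : Fin m → ℝ) (μ : Fin p → ℝ),
      (∀ k, 0 ≤ lam k) ∧ (∀ j, 0 ≤ μ j) ∧ ∑ k, lam k = 1 ∧
      (0 : IntervalGame.E n) ∈
        (∑ k, lam k • IntervalGame.weakGrad (G.ownLoss u i k) (u i))
          + (∑ j ∈ IntervalGame.active (G.g i) (u i),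
              μ j • IntervalGame.clarkeGrad (G.g i j) (u i))
          + (∑ k, (lam k * (ε k : ℝ)) • Metric.closedBall (0 : IntervalGame.E n) 1) ∧
      ∀ j, μ j * G.g i j (u i) = 0 := by
  intro i
  classical
  let A := active (G.g i) (u i)
  have hA : ∀ j, j ∈ A ↔ G.g i j (u i) = 0 := fun j => by simp [A, active]
  -- The competing functions: centers, widths and active constraints; the constraints carry no norm
  -- penalty in `c`.
  let ψ : (Fin m ⊕ Fin m) ⊕ A → E n → ℝ := Sum.elim
    (Sum.elim (fun k v => center (G.ownLoss u i k v)) (fun k v => width (G.ownLoss u i k v)))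
    (fun j => G.g i j)
  let c : (Fin m ⊕ Fin m) ⊕ A → ℝ :=
    Sum.elim (Sum.elim (fun k => (ε k : ℝ) / 2) (fun k => (ε k : ℝ) / 2)) (fun _ => 0)
  have hψ : ∀ a, LocallyLipschitz (ψ a) := by
    rintro ((k | k) | j)
    exacts [(hF i k).center, (hF i k).width, hg i j]
  have hc : ∀ a, 0 ≤ c a := by
    rintro ((k | k) | j)
    exacts [div_nonneg (ε k).coe_nonneg zero_le_two, div_nonneg (ε k).coe_nonneg zero_le_two, le_rfl]
  have hmin : ∀ᶠ y in 𝓝 (u i), ∃ a, ψ a (u i) ≤ ψ a y + c a * ‖y - u i‖ := by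
    have hin : ∀ᶠ y in 𝓝 (u i), ∀ j, j ∉ A → G.g i j y < 0 := by
      refine eventually_all.2 fun j => ?_
      by_cases hj : j ∈ A
      · exact Eventually.of_forall fun _ h => absurd hj h
      · have hlt : G.g i j (u i) < 0 := lt_of_le_of_ne (hu.1 i j) fun h => hj ((hA j).2 h)
        filter_upwards [(hg i j).continuous.continuousAt.eventually_lt continuousAt_const hlt]
          with y hy _ using hy
    filter_upwards [hin] with y hy
    by_cases hyS : y ∈ G.strategySet i
    · obtain ⟨k, hk | hk⟩ := hu.not_strictly_better i hyS
      exacts [⟨Sum.inl (Sum.inl k), hk⟩, ⟨Sum.inl (Sum.inr k), hk⟩]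
    · obtain ⟨j, hj⟩ : ∃ j, 0 < G.g i j y := by
        by_contra! h
        exact hyS h
      have hjA : j ∈ A := by
        by_contra h
        exact (hy j h).not_gt hj
      refine ⟨Sum.inr ⟨j, hjA⟩, ?_⟩
      simp only [ψ, c, Sum.elim_inr, zero_mul, add_zero]
      rw [(hA j).1 hjA]
      exact hj.le
  obtain ⟨α, x, y, hα, hα1, hx, hy, hsum⟩ := exists_multipliers_of_local_weak_min hψ hc hmin
  let a : Fin m → ℝ := fun k => α (Sum.inl (Sum.inl k))
  let b : Fin m → ℝ := fun k => α (Sum.inl (Sum.inr k))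
  have ha : ∀ k, 0 ≤ a k := fun k => hα _
  have hb : ∀ k, 0 ≤ b k := fun k => hα _
  let γ : Fin p → ℝ := fun j => if h : j ∈ A then α (Sum.inr ⟨j, h⟩) else 0
  have hγ : ∀ j, 0 ≤ γ j := fun j => by
    by_cases h : j ∈ A
    · simpa [γ, h] using hα _
    · simp [γ, h]
  have hγ0 : ∀ j, j ∉ A → γ j = 0 := fun j h => by simp [γ, h]
  -- Fillers for inactive indices: the Minkowski sum in `BCQ` runs over all `j`, so even a set
  -- scaled by `0` must contribute an element.
  choose x₀ hx₀ using fun j => clarkeGrad_nonempty (hg i j) (u i)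
  let ξ : Fin p → E n := fun j => if h : j ∈ A then x (Sum.inr ⟨j, h⟩) else x₀ j
  have hξ : ∀ j, ξ j ∈ clarkeGrad (G.g i j) (u i) := fun j => by
    by_cases h : j ∈ A
    · simp only [ξ, dif_pos h]
      exact hx (Sum.inr ⟨j, h⟩)
    · simpa [ξ, h] using hx₀ j
  have hyj : ∀ j : A, y (Sum.inr j) = 0 := fun j => norm_le_zero_iff.1 (hy (Sum.inr j))
  let P : Fin m → E n := fun k =>
    a k • x (Sum.inl (Sum.inl k)) + b k • x (Sum.inl (Sum.inr k))
  let R : Fin m → E n := fun k =>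
    a k • y (Sum.inl (Sum.inl k)) + b k • y (Sum.inl (Sum.inr k))
  have hsumA : ∑ j : A, α (Sum.inr j) • (x (Sum.inr j) + y (Sum.inr j)) =
      ∑ j ∈ A, γ j • ξ j := by
    rw [← Finset.sum_coe_sort A]
    exact Finset.sum_congr rfl fun j _ => by simp [γ, ξ, hyj]
  have hsumγ : ∑ j : A, α (Sum.inr j) = ∑ j ∈ A, γ j := by
    rw [← Finset.sum_coe_sort A]
    exact Finset.sum_congr rfl fun j _ => by simp [γ]
  have hzero : ∑ k, P k + ∑ j ∈ A, γ j • ξ j + ∑ k, R k = 0 := by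
    rw [Fintype.sum_sum_type, Fintype.sum_sum_type, hsumA] at hsum
    rw [← hsum]
    simp only [P, R, a, b, smul_add, Finset.sum_add_distrib]
    abel
  have hone : ∑ k, (a k + b k) + ∑ j ∈ A, γ j = 1 := by
    rw [Fintype.sum_sum_type, Fintype.sum_sum_type, hsumγ] at hα1
    rw [Finset.sum_add_distrib, ← hα1]
  let s : ℝ := ∑ k, (a k + b k)
  have hs0 : 0 ≤ s := Finset.sum_nonneg fun k _ => add_nonneg (ha k) (hb k)
  -- If `s = 0`, every loss weight vanishes, so `γ` has total weight `1` and the relation involves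
  -- constraint gradients only, contradicting BCQ.
  have hs : 0 < s := by
    refine hs0.lt_of_ne fun hs => hBCQ i ⟨γ, hγ, ?_, hγ0, ?_⟩
    · intro h
      have : s + ∑ j ∈ A, γ j = 1 := hone
      simp [← hs, h] at this
    · have hk : ∀ k, a k + b k = 0 := fun k =>
        (Finset.sum_eq_zero_iff_of_nonneg fun k _ => add_nonneg (ha k) (hb k)).1 hs.symm k
          (Finset.mem_univ k)
      have hak : ∀ k, a k = 0 := fun k => by linarith [hk k, ha k, hb k]
      have hbk : ∀ k, b k = 0 := fun k => by linarith [hk k, ha k, hb k]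
      rw [Set.mem_fintype_sum]
      refine ⟨fun j => γ j • ξ j, fun j => Set.smul_mem_smul_set (hξ j), ?_⟩
      rw [← Finset.sum_subset (Finset.subset_univ A) fun j _ hj => by simp [hγ0 j hj]]
      simpa [P, R, hak, hbk] using hzero
  have hsi : 0 ≤ s⁻¹ := inv_nonneg.2 hs0
  refine ⟨fun k => s⁻¹ * a k + s⁻¹ * b k, fun j => s⁻¹ * γ j,
    fun k => add_nonneg (mul_nonneg hsi (ha k)) (mul_nonneg hsi (hb k)),
    fun j => mul_nonneg hsi (hγ j), ?_, ?_, fun j => ?_⟩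
  · simp only [← mul_add]
    rw [← Finset.mul_sum]
    exact inv_mul_cancel₀ hs.ne'
  · have hz : ∑ k, s⁻¹ • P k + ∑ j ∈ A, s⁻¹ • γ j • ξ j + ∑ k, s⁻¹ • R k = 0 := by
      rw [← Finset.smul_sum, ← Finset.smul_sum, ← Finset.smul_sum, ← smul_add, ← smul_add,
        hzero, smul_zero]
    refine Set.mem_add.2 ⟨_, Set.add_mem_add (a := ∑ k, s⁻¹ • P k)
      (b := ∑ j ∈ A, s⁻¹ • γ j • ξ j) ?_ ?_, ∑ k, s⁻¹ • R k, ?_, hz⟩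
    · refine Set.finsetSum_mem_finsetSum _ _ _ fun k _ => ?_
      simp only [P, smul_add, smul_smul]
      exact smul_add_smul_mem_smul_weakGrad (hx (Sum.inl (Sum.inl k)))
        (hx (Sum.inl (Sum.inr k))) (mul_nonneg hsi (ha k)) (mul_nonneg hsi (hb k))
    · refine Set.finsetSum_mem_finsetSum _ _ _ fun j _ => ?_
      rw [smul_smul]
      exact Set.smul_mem_smul_set (hξ j)
    · refine Set.finsetSum_mem_finsetSum _ _ _ fun k _ => ?_
      simp only [R, smul_add, smul_smul]
      exact smul_add_smul_mem_smul_closedBall (ε k).coe_nonneg (hy (Sum.inl (Sum.inl k)))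
        (hy (Sum.inl (Sum.inr k))) (mul_nonneg hsi (ha k)) (mul_nonneg hsi (hb k))
  · by_cases h : j ∈ A
    · rw [(hA j).1 h, mul_zero]
    · simp [hγ0 j h]
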